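/- Let $\mathbb F$ be $\mathbb R$ or $\mathbb C$, let $m\ge 1$ and $n\ge 0$ be integers, and let $\underline d=(d_1,\dots,d_m)$ be a list of nonnegative integers. Let $\mathbb F[\lambda]^{m\times(m+n)}_{\underline d}$ be the set of $m\times(m+n)$ polynomial matrices over $\mathbb F$ whose $i$-th row has degree at most $d_i$, for $i=1,\dots,m$. A polynomial matrix with $m$ rows is a *minimal basis* if its rows are linearly independent over $\mathbb F(\lambda)$ and the sum of their degrees (the degree of a polynomial vector being the highest degree of its entries) is minimal among all bases, consisting of polynomial vectors, of the $\mathbb F(\lambda)$-subspace that they span. For $M(\lambda)\in\mathbb F[\lambda]^{m\times(m+n)}_{\underline d}$ let $R_{i,j}\in\mathbb F^{1\times(m+n)}$ be the coefficient of $\lambda^j$ in its $i$-th row. The leading row-wise coefficient matrix $M_{\underline d}\in\mathbb F^{m\times(m+n)}$ has the rows $R_{1,d_1},\dots,R_{m,d_m}$. With $d=\max_i d_i$ and $M(\lambda)=\sum_{j=0}^d M_j\lambda^j$, the $k$-th Sylvester matrix $S_k(M)\in\mathbb F^{(k+d)m\times k(m+n)}$ ($k\ge1$) is the block matrix with $k+d$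 block rows and $k$ block columns whose block in position $(r,c)$ is $M_{r-c}$ if $0\le r-c\le d$ and $0$ otherwise. The $k$-th trimmed Sylvester matrix $T_k(M)\in\mathbb F^{(km+\sum_i d_i)\times k(m+n)}$ is obtained from $S_k(M)$ by removing, for each $i$, the $i$-th row of each of the last $d-d_i$ block rows. Let $\|\cdot\|_2$ be the spectral norm and $\sigma_j(A)$ the $j$-th largest singular value of $A$. **Theorem.** Let $M(\lambda)\in\mathbb F[\lambda]^{m\times(m+n)}_{\underline d}$ be a minimal basis. (a) If $\operatorname{rank}(M_{\underline d})<m$, then for every $\epsilon>0$ there is $\widetilde M(\lambda)\in\mathbb F[\lambda]^{m\times(m+n)}_{\underline d}$ that is not a minimal basis and satisfies $\|T_1(M)-T_1(\widetilde M)\|_2<\epsilon$. (b) If $\operatorname{rank}(M_{\underline d})=m$, then there is an index $k\ge1$ such that $T_k(M)$ has full row rank. Moreover, for every such $k$, the number $\sigma_{km+\sum_{i} d_i}(T_k(M))$ is positive, and every $\widetilde M(\lambda)\in\mathbb F[\lambda]^{m\times(m+n)}_{\underline d}$ that satisfies $$\|T_1(M)-T_1(\widetilde M)\|_2<\frac{\sigma_{km+\sum_{i=1}^m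 d_i}(T_k(M))}{\sqrt k}$$ is a minimal basis with $\operatorname{rank}(\widetilde M_{\underline d})=m$. -/

import Mathlib

open Polynomial
open scoped Matrix.Norms.L2Operator

/-- The degree of a polynomial vector: the highest degree of its entries. -/
noncomputable def polyVecDegree {F ι : Type*} [Field F] [Fintype ι] (v : ι → F[X]) : ℕ :=
  Finset.univ.sup fun j => (v j).natDegree

/-- A polynomial vector, seen as a vector with entries in the field `F(λ)`. -/
noncomputable def toRational {F ι : Type*} [Field F] (v : ι → F[X]) : ι → RatFunc F :=
  fun j => algebraMap F[X] (RatFunc F) (v j)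

/-- `v₁, …, vₘ` are polynomial vectors that form a basis of the rational subspace `V`. -/
def IsPolynomialBasis {F ι : Type*} [Field F] {m : ℕ}
    (V : Submodule (RatFunc F) (ι → RatFunc F)) (v : Fin m → ι → F[X]) : Prop :=
  LinearIndependent (RatFunc F) (fun i => toRational (v i)) ∧
    Submodule.span (RatFunc F) (Set.range fun i => toRational (v i)) = V

/-- Forney's notion: a polynomial basis of `V` whose sum of degrees is minimal among all
polynomial bases of `V` (which all have the same number `m` of elements). -/
def IsMinimalBasisOf {F ι : Type*} [Field F] [Fintype ι] {m : ℕ}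
    (V : Submodule (RatFunc F) (ι → RatFunc F)) (v : Fin m → ι → F[X]) : Prop :=
  IsPolynomialBasis V v ∧
    ∀ w : Fin m → ι → F[X], IsPolynomialBasis V w →
      ∑ i, polyVecDegree (v i) ≤ ∑ i, polyVecDegree (w i)

/-- The polynomial matrix `M` is a minimal basis: its rows form a minimal basis of the rational
subspace that they span. -/
def IsMinimalBasis {F ι : Type*} [Field F] [Fintype ι] {m : ℕ} (M : Matrix (Fin m) ι F[X]) :
    Prop :=
  IsMinimalBasisOf (Submodule.span (RatFunc F) (Set.range fun i => toRational (M i))) M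

/-- The set of polynomial matrices whose `i`-th row has degree at most `d i`. -/
def rowDegreeSpace {F ι : Type*} [Field F] {m : ℕ} (d : Fin m → ℕ) :
    Set (Matrix (Fin m) ι F[X]) :=
  {M | ∀ i j, (M i j).natDegree ≤ d i}

/-- The leading row-wise coefficient matrix: its `i`-th row is the vector coefficient of
`λ ^ (d i)` in the `i`-th row of `M`. -/
def leadingRowCoeff {F ι : Type*} [Field F] {m : ℕ} (d : Fin m → ℕ)
    (M : Matrix (Fin m) ι F[X]) : Matrix (Fin m) ι F :=
  Matrix.of fun i j => (M i j).coeff (d i)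

/-- The `k`-th Sylvester matrix of a polynomial matrix of degree at most `D`: it has `k + D` block
rows and `k` block columns, and its block in position `(r, c)` (numbered from `0`) is the matrix
coefficient of `λ ^ (r - c)` if `c ≤ r` (which vanishes if `r - c > D`), and `0` otherwise. -/
def sylvesterMatrix {F ι : Type*} [Field F] {m : ℕ} (D k : ℕ) (M : Matrix (Fin m) ι F[X]) :
    Matrix (Fin (k + D) × Fin m) (Fin k × ι) F :=
  Matrix.of fun p q =>
    if (q.1 : ℕ) ≤ (p.1 : ℕ) then (M p.2 q.2).coeff ((p.1 : ℕ) - (q.1 : ℕ)) else 0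

/-- The rows of the Sylvester matrix (with `D = max d`) that are kept: those that come from the
`i`-th row of `M` and lie in one of the first `k + d i` block rows. -/
def keptRow {m : ℕ} (d : Fin m → ℕ) (k : ℕ) (p : Σ i : Fin m, Fin (k + d i)) :
    Fin (k + Finset.univ.sup d) × Fin m :=
  (Fin.castLE (Nat.add_le_add_left (Finset.le_sup (f := d) (Finset.mem_univ p.1)) k) p.2, p.1)

/-- The `k`-th trimmed Sylvester matrix: for each `i`, the last `max d - d i` among the rows of the
Sylvester matrix that come from the `i`-th row of `M` are removed. -/
def trimmedSylvester {F ι : Type*} [Field F] {m : ℕ} (d : Fin m → ℕ) (k : ℕ)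
    (M : Matrix (Fin m) ι F[X]) : Matrix (Σ i : Fin m, Fin (k + d i)) (Fin k × ι) F :=
  (sylvesterMatrix (Finset.univ.sup d) k M).submatrix (keptRow d k) id

/-- `σ_j(A)`, the `j`-th largest singular value of the matrix `A`, where `j = 1, 2, …`
(Mathlib numbers the singular values from `0`). -/
noncomputable def matrixSingularValue {𝕜 ρ κ : Type*} [RCLike 𝕜] [Fintype ρ] [Fintype κ]
    [DecidableEq κ] (A : Matrix ρ κ 𝕜) (j : ℕ) : ℝ :=
  (Matrix.toEuclideanLin A).singularValues (j - 1)

/-! The matrix `trimmedSylvester d k M` represents the map x ↦ Mx from polynomial vectors of degree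
less than k to those whose i-th entry has degree less than k + d i. Its full row rank is therefore
`SurjectiveInDegree d k M`. For M in `rowDegreeSpace d` and k ≥ 1 this forces x ↦ Mx to be onto all
polynomial vectors (left primeness) and M_d to have full row rank, and the two together make M a
minimal basis (`isMinimalBasis_of_surjective`). Conversely a minimal basis is left prime, and left
primeness with full rank of M_d gives surjectivity in degree for some k
(`exists_surjectiveInDegree`).

For (b), full row rank of T_k survives any perturbation of norm less than its last singular value
(`matrixSingularValue_le_norm_sub`), and T_k depends linearly on M with ‖T_k‖ ≤ √k ‖T_1‖.

For (a), a left null vector of M_d yields a combination of rows whose leading terms cancel, so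
minimality forces some row to have degree below d i. Multiplying that row by 1 + δλ keeps the degree
bounds, destroys minimality, and is an arbitrarily small change. -/

theorem toRational_sum_smul {F ι κ : Type*} [Field F] (s : Finset κ) (c : κ → F[X])
    (v : κ → ι → F[X]) :
    toRational (∑ j ∈ s, c j • v j) =
      ∑ j ∈ s, algebraMap F[X] (RatFunc F) (c j) • toRational (v j) := by
  ext i
  simp only [toRational, Finset.sum_apply, Pi.smul_apply, smul_eq_mul, map_sum, map_mul]

theorem toRational_smul {F ι : Type*} [Field F] (c : F[X]) (v : ι → F[X]) :
    toRational (c • v) = algebraMap F[X] (RatFunc F) c • toRational v := by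
  ext i
  simp [toRational]

theorem toRational_zero {F ι : Type*} [Field F] : toRational (0 : ι → F[X]) = 0 := by
  ext i
  simp [toRational]

theorem toRational_injective {F ι : Type*} [Field F] :
    Function.Injective (toRational : (ι → F[X]) → ι → RatFunc F) := by
  intro v w h
  ext1 i
  exact RatFunc.algebraMap_injective F (congrFun h i)

theorem natDegree_le_polyVecDegree {F ι : Type*} [Field F] [Fintype ι] (v : ι → F[X]) (i : ι) :
    (v i).natDegree ≤ polyVecDegree v :=
  Finset.le_sup (f := fun j => (v j).natDegree) (Finset.mem_univ i)

theorem polyVecDegree_le {F ι : Type*} [Field F] [Fintype ι] {v : ι → F[X]} {e : ℕ}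
    (h : ∀ i, (v i).natDegree ≤ e) : polyVecDegree v ≤ e :=
  Finset.sup_le fun i _ => h i

/-! ### Exchange of rows in polynomial bases -/

/-- A spanning family with as many elements as a polynomial basis is a polynomial basis. -/
theorem IsPolynomialBasis.of_span_eq {F ι : Type*} [Field F] {m : ℕ}
    {V : Submodule (RatFunc F) (ι → RatFunc F)} {v w : Fin m → ι → F[X]}
    (hv : IsPolynomialBasis V v)
    (hw : Submodule.span (RatFunc F) (Set.range fun i => toRational (w i)) = V) :
    IsPolynomialBasis V w := by
  refine ⟨?_, hw⟩
  rw [linearIndependent_iff_card_eq_finrank_span, Set.finrank, hw, ← hv.2]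
  exact linearIndependent_iff_card_eq_finrank_span.1 hv.1

/-- Over F(λ) the relation can be divided by p to express w, and by c i to recover v i from w and
the other rows, so the span is unchanged. -/
theorem IsPolynomialBasis.update {F ι : Type*} [Field F] {m : ℕ}
    {V : Submodule (RatFunc F) (ι → RatFunc F)} {v : Fin m → ι → F[X]}
    (hv : IsPolynomialBasis V v) {w : ι → F[X]} {p : F[X]} {c : Fin m → F[X]} {i : Fin m}
    (hp : p ≠ 0) (hc : c i ≠ 0) (h : p • w = ∑ j, c j • v j) :
    IsPolynomialBasis V (Function.update v i w) := by
  classical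
  apply hv.of_span_eq
  have hp' : algebraMap F[X] (RatFunc F) p ≠ 0 := by simpa using hp
  have hc' : algebraMap F[X] (RatFunc F) (c i) ≠ 0 := by simpa using hc
  have h' : algebraMap F[X] (RatFunc F) p • toRational w =
      ∑ j, algebraMap F[X] (RatFunc F) (c j) • toRational (v j) := by
    rw [← toRational_smul, h, toRational_sum_smul]
  rw [← hv.2]
  apply le_antisymm
  · rw [Submodule.span_le]
    rintro _ ⟨j, rfl⟩
    by_cases hj : j = i
    · subst hj
      simp only [Function.update_self]
      rw [SetLike.mem_coe, ← Submodule.smul_mem_iff _ hp', h']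
      exact Submodule.sum_mem _ fun j _ =>
        Submodule.smul_mem _ _ (Submodule.subset_span ⟨j, rfl⟩)
    · simp only [Function.update_of_ne hj]
      exact Submodule.subset_span ⟨j, rfl⟩
  · rw [Submodule.span_le]
    set W := Submodule.span (RatFunc F)
      (Set.range fun j => toRational (Function.update v i w j)) with hW
    have hne : ∀ j, j ≠ i → toRational (v j) ∈ W := fun j hj =>
      Submodule.subset_span ⟨j, by simp [Function.update_of_ne hj]⟩
    have hi : toRational w ∈ W := Submodule.subset_span ⟨i, by simp⟩
    rintro _ ⟨j, rfl⟩
    by_cases hj : j = i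
    · subst hj
      rw [SetLike.mem_coe, ← Submodule.smul_mem_iff _ hc']
      rw [← Finset.add_sum_erase _ _ (Finset.mem_univ j)] at h'
      rw [eq_sub_of_add_eq h'.symm]
      exact W.sub_mem (W.smul_mem _ hi)
        (W.sum_mem fun k hk => W.smul_mem _ (hne k (Finset.ne_of_mem_erase hk)))
    · exact hne j hj

theorem sum_update_lt {m : ℕ} {f g : Fin m → ℕ} {i : Fin m} (hi : g i < f i)
    (h : ∀ j, j ≠ i → g j = f j) : ∑ j, g j < ∑ j, f j :=
  Finset.sum_lt_sum (fun j _ => by by_cases hj : j = i; exacts [hj ▸ hi.le, (h j hj).le])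
    ⟨i, Finset.mem_univ i, hi⟩

/-- In a minimal basis no row can be exchanged for a polynomial vector of smaller degree. -/
theorem IsMinimalBasisOf.polyVecDegree_le_of_exchange {F ι : Type*} [Field F] [Fintype ι] {m : ℕ}
    {V : Submodule (RatFunc F) (ι → RatFunc F)} {v : Fin m → ι → F[X]}
    (hM : IsMinimalBasisOf V v) {w : ι → F[X]} {p : F[X]}
    {c : Fin m → F[X]} {i : Fin m} (hp : p ≠ 0) (hc : c i ≠ 0) (h : p • w = ∑ j, c j • v j) :
    polyVecDegree (v i) ≤ polyVecDegree w := by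
  by_contra! hlt
  refine (hM.2 _ (hM.1.update hp hc h)).not_gt (sum_update_lt (i := i) ?_ ?_)
  · simpa using hlt
  · intro j hj
    simp [Function.update_of_ne hj]

theorem IsMinimalBasisOf.row_ne_zero {F ι : Type*} [Field F] [Fintype ι] {m : ℕ}
    {V : Submodule (RatFunc F) (ι → RatFunc F)} {v : Fin m → ι → F[X]}
    (hM : IsMinimalBasisOf V v) (i : Fin m) : v i ≠ 0 := by
  intro h
  exact hM.1.1.ne_zero i (by simp [h, toRational_zero])

/-- A nontrivial polynomial combination of the rows of a minimal basis does not vanish. -/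
theorem IsMinimalBasisOf.sum_smul_ne_zero {F ι : Type*} [Field F] [Fintype ι] {m : ℕ}
    {V : Submodule (RatFunc F) (ι → RatFunc F)} {v : Fin m → ι → F[X]}
    (hM : IsMinimalBasisOf V v) {c : Fin m → F[X]} {i : Fin m}
    (hc : c i ≠ 0) : ∑ j, c j • v j ≠ 0 := by
  intro h
  have h1 := Fintype.linearIndependent_iff.1 hM.1.1
    (fun j => algebraMap F[X] (RatFunc F) (c j))
    (by rw [← toRational_sum_smul, h, toRational_zero]) i
  exact hc (by simpa using h1)

/-- Multiplying a row of a minimal basis by a nonconstant polynomial destroys minimality. -/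
theorem IsMinimalBasisOf.not_isMinimalBasisOf_update_smul {F ι : Type*} [Field F] [Fintype ι]
    {m : ℕ} {V : Submodule (RatFunc F) (ι → RatFunc F)} {v : Fin m → ι → F[X]}
    (hM : IsMinimalBasisOf V v) (i : Fin m) {p : F[X]}
    (hp : 0 < p.natDegree)
    (V' : Submodule (RatFunc F) (ι → RatFunc F)) :
    ¬ IsMinimalBasisOf V' (Function.update v i (p • v i)) := by
  intro h
  have hp0 : p ≠ 0 := by rintro rfl; simp at hp
  obtain ⟨j, hj⟩ : ∃ j, v i j ≠ 0 := by
    by_contra! h0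
    exact hM.row_ne_zero i (funext h0)
  -- The relation p • v i = 1 • (p • v i) permits exchanging the scaled row for the original one.
  set c : Fin m → F[X] := Pi.single i 1 with hc
  have h1 := h.polyVecDegree_le_of_exchange (w := v i) (p := p) (c := c) (i := i) hp0
    (by simp [hc]) (by
      rw [Finset.sum_eq_single i]
      · simp [hc]
      · intro j _ hj
        simp [hc, hj]
      · simp)
  have hne : (Finset.univ : Finset ι).Nonempty := ⟨j, Finset.mem_univ j⟩
  obtain ⟨l, -, hl⟩ := Finset.exists_max_image Finset.univ (fun l => (v i l).natDegree) hne
  -- Since `natDegree 0 = 0`, the maximizing entry may vanish; then every entry has degree 0 and the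
  -- nonzero entry j serves instead.
  by_cases hl0 : v i l = 0
  · have hdeg : polyVecDegree (v i) = 0 :=
      Nat.le_zero.1 (polyVecDegree_le fun k => (hl k (Finset.mem_univ k)).trans (by simp [hl0]))
    have h2 := natDegree_le_polyVecDegree (p • v i) j
    simp only [Function.update_self] at h1
    rw [Pi.smul_apply, smul_eq_mul, natDegree_mul hp0 hj] at h2
    omega
  · have hdeg : polyVecDegree (v i) ≤ (v i l).natDegree :=
      polyVecDegree_le fun k => hl k (Finset.mem_univ k)
    have h2 := natDegree_le_polyVecDegree (p • v i) l
    simp only [Function.update_self] at h1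
    rw [Pi.smul_apply, smul_eq_mul, natDegree_mul hp0 hl0] at h2
    omega

/-! ### Rank-deficient leading coefficients -/

theorem natDegree_lt_of_coeff_eq_zero {F : Type*} [Field F] {p : F[X]} {e : ℕ}
    (hp : ∀ k, e ≤ k → p.coeff k = 0) : p = 0 ∨ p.natDegree < e := by
  by_contra! h
  exact leadingCoeff_ne_zero.2 h.1 (hp _ h.2)

theorem exists_vecMul_eq_zero_of_rank_lt {F ι : Type*} [Field F] [Fintype ι] {m : ℕ}
    {A : Matrix (Fin m) ι F} (h : A.rank < m) :
    ∃ v : Fin m → F, v ≠ 0 ∧ ∀ l, ∑ j, v j * A j l = 0 := by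
  by_contra! h0
  have hli : LinearIndependent F A.row := by
    rw [Fintype.linearIndependent_iff]
    intro g hg
    by_contra! hne
    obtain ⟨i, hi⟩ := hne
    obtain ⟨l, hl⟩ := h0 g (fun h => hi (congrFun h i))
    apply hl
    have := congrFun hg l
    simpa [Finset.sum_apply] using this
  have := hli.rank_matrix
  simp at this
  omega

/-- If the leading row-wise coefficient matrix of a minimal basis is rank deficient, some row has
smaller degree than prescribed. -/
theorem IsMinimalBasisOf.exists_polyVecDegree_lt {F ι : Type*} [Field F] [Fintype ι] {m : ℕ}
    {V : Submodule (RatFunc F) (ι → RatFunc F)} {d : Fin m → ℕ} {M : Matrix (Fin m) ι F[X]}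
    (hM : IsMinimalBasisOf V M) (hd : M ∈ rowDegreeSpace d) (hr : (leadingRowCoeff d M).rank < m) :
    ∃ i, polyVecDegree (M i) < d i := by
  classical
  obtain ⟨v, hv0, hv⟩ := exists_vecMul_eq_zero_of_rank_lt hr
  obtain ⟨i₀, hi₀⟩ := Function.ne_iff.1 hv0
  obtain ⟨i, hi, hmax⟩ := Finset.exists_max_image (Finset.univ.filter fun j => v j ≠ 0) d
    ⟨i₀, by simpa using hi₀⟩
  simp only [Finset.mem_filter, Finset.mem_univ, true_and] at hi hmax
  refine ⟨i, ?_⟩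
  -- The shifts align the leading terms at λ ^ (d i), where their sum is the entry of v M_d = 0.
  -- Maximality of d i keeps the subtraction from truncating when v j ≠ 0.
  set c : Fin m → F[X] := fun j => C (v j) * X ^ (d i - d j) with hc
  have hci : c i ≠ 0 := by simpa [hc] using hi
  set w : ι → F[X] := ∑ j, c j • M j with hw
  have hw0 : w ≠ 0 := hM.sum_smul_ne_zero hci
  have hcoeff : ∀ l k, d i ≤ k → (w l).coeff k = 0 := by
    intro l k hk
    have h1 : (w l).coeff k = ∑ j, v j * (M j l).coeff (k - (d i - d j)) := by
      simp only [hw, Finset.sum_apply, Pi.smul_apply, smul_eq_mul, finsetSum_coeff, hc, mul_assoc,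
        coeff_C_mul, coeff_X_pow_mul']
      refine Finset.sum_congr rfl fun j _ => ?_
      rw [if_pos (by omega)]
    rw [h1]
    rcases hk.eq_or_lt with rfl | hlt
    · rw [← hv l]
      refine Finset.sum_congr rfl fun j _ => ?_
      by_cases hj : v j = 0
      · simp [hj]
      · rw [Nat.sub_sub_self (hmax j hj)]
        rfl
    · refine Finset.sum_eq_zero fun j _ => ?_
      by_cases hj : v j = 0
      · simp [hj]
      · rw [coeff_eq_zero_of_natDegree_lt, mul_zero]
        have := hd j l
        have := hmax j hj
        omega
  -- A nonzero entry of w forces d i > 0, without which d i - 1 would not be a smaller degree.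
  obtain ⟨l, hl⟩ := Function.ne_iff.1 hw0
  have hpos := (natDegree_lt_of_coeff_eq_zero (hcoeff l)).resolve_left hl
  have hle := hM.polyVecDegree_le_of_exchange (w := w) (p := 1) one_ne_zero hci (one_smul _ _)
  have : polyVecDegree w ≤ d i - 1 := polyVecDegree_le fun l => by
    rcases natDegree_lt_of_coeff_eq_zero (hcoeff l) with h | h
    · simp [h]
    · omega
  omega

/-! ### Minimal bases are left prime -/

/-- A submodule of `F[X]ᵐ` that is not everything is killed by a nonzero functional to `F[X] / p`,
given by polynomials of degree less than that of `p`. -/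
theorem exists_dvd_of_ne_top {F : Type*} [Field F] {m : ℕ}
    {N : Submodule F[X] (Fin m → F[X])} (hN : N ≠ ⊤) :
    ∃ p : F[X], p ≠ 0 ∧ ∃ c : Fin m → F[X], (∀ j, (c j).natDegree < p.natDegree) ∧ c ≠ 0 ∧
      ∀ y ∈ N, p ∣ ∑ j, c j * y j := by
  -- The quotient by a maximal submodule K ⊇ N is simple, hence F[X] / (p) with (p) maximal; p ≠ 0
  -- because F[X] is not a field.
  obtain ⟨K, hK, hNK⟩ := (eq_top_or_exists_le_coatom N).resolve_left hN
  obtain ⟨I, hI, ⟨e⟩⟩ := isSimpleModule_iff_quot_maximal.1 (isSimpleModule_iff_isCoatom.2 hK)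
  set p := Submodule.IsPrincipal.generator I with hp
  have hpI : Ideal.span {p} = I := Ideal.span_singleton_generator I
  have hp0 : p ≠ 0 := by
    intro h
    exact Ring.ne_bot_of_isMaximal_of_not_isField hI (Polynomial.not_isField F)
      (by rw [← hpI, h]; simp)
  have hpu : ¬ IsUnit p := fun h => hI.ne_top (by rw [← hpI, Ideal.span_singleton_eq_top.2 h])
  have hpd : p.natDegree ≠ 0 := fun h => hpu (by
    rw [eq_C_of_natDegree_eq_zero h] at hp0 ⊢
    rw [isUnit_C, isUnit_iff_ne_zero]
    simpa using hp0)
  set g : (Fin m → F[X]) →ₗ[F[X]] F[X] ⧸ I := e.toLinearMap ∘ₗ K.mkQ with hg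
  have hgs : Function.Surjective g := e.surjective.comp K.mkQ_surjective
  -- The functional is determined by its values on the unit vectors; lifts of these are reduced mod
  -- p to lower their degree.
  choose c' hc' using fun j => Ideal.Quotient.mk_surjective (g (Pi.single j 1))
  have hmod : ∀ j, Ideal.Quotient.mk I (c' j % p) = g (Pi.single j 1) := by
    intro j
    rw [← hc', Ideal.Quotient.eq, ← hpI, Ideal.mem_span_singleton]
    exact ⟨-(c' j / p), by linear_combination EuclideanDomain.mod_add_div (c' j) p⟩
  have hgy : ∀ y, g y = Ideal.Quotient.mk I (∑ j, c' j % p * y j) := by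
    intro y
    conv_lhs => rw [pi_eq_sum_univ' y]
    simp only [map_sum, map_mul, hmod, map_smul]
    refine Finset.sum_congr rfl fun j _ => ?_
    rw [mul_comm]
    rfl
  refine ⟨p, hp0, fun j => c' j % p, fun j => natDegree_mod_lt _ hpd, ?_, ?_⟩
  · intro h
    obtain ⟨y, hy⟩ := hgs (Ideal.Quotient.mk I 1)
    rw [hgy] at hy
    have h0 : ∀ j, c' j % p = 0 := fun j => congrFun h j
    simp only [h0, zero_mul, Finset.sum_const_zero, map_zero] at hy
    have : (1 : F[X]) ∈ I := Ideal.Quotient.eq_zero_iff_mem.1 hy.symm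
    exact hI.ne_top ((Ideal.eq_top_iff_one I).2 this)
  · intro y hy
    rw [← Ideal.mem_span_singleton, hpI, ← Ideal.Quotient.eq_zero_iff_mem, ← hgy, hg]
    simp [(Submodule.Quotient.mk_eq_zero K).2 (hNK hy)]

/-- A minimal basis is left prime: it induces a surjective map of polynomial vectors. -/
theorem IsMinimalBasisOf.mulVec_surjective {F ι : Type*} [Field F] [Fintype ι] {m : ℕ}
    {V : Submodule (RatFunc F) (ι → RatFunc F)} {M : Matrix (Fin m) ι F[X]}
    (hM : IsMinimalBasisOf V M) : Function.Surjective M.mulVec := by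
  classical
  by_contra hns
  have hN : LinearMap.range M.mulVecLin ≠ ⊤ := fun h => hns (LinearMap.range_eq_top.1 h)
  -- Applied to the columns of M, the functional shows that p divides ∑ c j • M j. As the c j have
  -- degree less than p, the quotient w has smaller degree than the largest row involved, and can
  -- replace it.
  obtain ⟨p, hp, c, hcd, hc0, hdvd⟩ := exists_dvd_of_ne_top hN
  have hdvd' : ∀ l, p ∣ ∑ j, c j * M j l := fun l => by
    have := hdvd (M.mulVec (Pi.single l 1)) ⟨_, rfl⟩
    simpa using this
  choose w hw using hdvd'
  obtain ⟨i₀, hi₀⟩ := Function.ne_iff.1 hc0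
  obtain ⟨i, hi, hmax⟩ := Finset.exists_max_image (Finset.univ.filter fun j => c j ≠ 0)
    (fun j => polyVecDegree (M j)) ⟨i₀, by simpa using hi₀⟩
  simp only [Finset.mem_filter, Finset.mem_univ, true_and] at hi hmax
  have hpw : p • w = ∑ j, c j • M j := by
    ext1 l
    simp [Finset.sum_apply, ← hw l]
  have hw0 : w ≠ 0 := by
    rintro rfl
    exact hM.sum_smul_ne_zero hi (by rw [← hpw, smul_zero])
  have hdeg : ∀ l, w l ≠ 0 → (w l).natDegree < polyVecDegree (M i) := by
    intro l hl
    have h1 : (∑ j, c j * M j l).natDegree ≤ p.natDegree - 1 + polyVecDegree (M i) := by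
      refine natDegree_sum_le_of_forall_le _ _ fun j _ => ?_
      by_cases hj : c j = 0
      · simp [hj]
      · have := natDegree_le_polyVecDegree (M j) l
        have := hmax j hj
        have := hcd j
        exact natDegree_mul_le.trans (by omega)
    rw [hw l, natDegree_mul hp hl] at h1
    have := hcd i
    omega
  obtain ⟨l, hl⟩ := Function.ne_iff.1 hw0
  have hpos := hdeg l hl
  have : polyVecDegree w ≤ polyVecDegree (M i) - 1 := polyVecDegree_le fun l => by
    by_cases hl : w l = 0
    · simp [hl]
    · have := hdeg l hl
      omega
  have := hM.polyVecDegree_le_of_exchange hp hi hpw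
  omega

/-! ### Singular values and distance to lower rank -/

/-- Expand ⟨x, T*T x⟩ = ‖T x‖² in an orthonormal eigenbasis of T*T. -/
theorem LinearMap.sq_norm_apply_eq_sum {𝕜 E F : Type*} [RCLike 𝕜]
    [NormedAddCommGroup E] [InnerProductSpace 𝕜 E] [FiniteDimensional 𝕜 E]
    [NormedAddCommGroup F] [InnerProductSpace 𝕜 F] [FiniteDimensional 𝕜 F]
    (T : E →ₗ[𝕜] F) (x : E) :
    ‖T x‖ ^ 2 = ∑ i, T.isSymmetric_adjoint_comp_self.eigenvalues rfl i *
      ‖inner 𝕜 (T.isSymmetric_adjoint_comp_self.eigenvectorBasis rfl i) x‖ ^ 2 := by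
  have hsym := T.isSymmetric_adjoint_comp_self
  have h1 : inner 𝕜 (T x) (T x) = inner 𝕜 x ((T.adjoint ∘ₗ T) x) := by
    rw [LinearMap.comp_apply, LinearMap.adjoint_inner_right]
  have h2 : ((‖T x‖ ^ 2 : ℝ) : 𝕜) = ∑ i, ((hsym.eigenvalues rfl i *
      ‖inner 𝕜 (hsym.eigenvectorBasis rfl i) x‖ ^ 2 : ℝ) : 𝕜) := by
    rw [RCLike.ofReal_pow, ← inner_self_eq_norm_sq_to_K, h1,
      ← OrthonormalBasis.sum_inner_mul_inner (hsym.eigenvectorBasis rfl)]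
    refine Finset.sum_congr rfl fun i _ => ?_
    rw [← OrthonormalBasis.repr_apply_apply _ ((T.adjoint ∘ₗ T) x),
      hsym.eigenvectorBasis_apply_self_apply rfl, OrthonormalBasis.repr_apply_apply, mul_left_comm,
      ← inner_conj_symm x, RCLike.conj_mul]
    push_cast
    rfl
  exact_mod_cast h2

/-- The span of the first `N` right singular vectors, on which the linear map is bounded below by
the `N`-th singular value. -/
theorem LinearMap.exists_submodule_singularValues_mul_norm_le {𝕜 E F : Type*} [RCLike 𝕜]
    [NormedAddCommGroup E] [InnerProductSpace 𝕜 E] [FiniteDimensional 𝕜 E]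
    [NormedAddCommGroup F] [InnerProductSpace 𝕜 F] [FiniteDimensional 𝕜 F]
    (T : E →ₗ[𝕜] F) {N : ℕ} (hN : N ≤ Module.finrank 𝕜 E) :
    ∃ W : Submodule 𝕜 E, Module.finrank 𝕜 W = N ∧
      ∀ x ∈ W, T.singularValues (N - 1) * ‖x‖ ≤ ‖T x‖ := by
  have hsym := T.isSymmetric_adjoint_comp_self
  set b := hsym.eigenvectorBasis rfl with hb
  refine ⟨Submodule.span 𝕜 (Set.range fun i : Fin N => b (Fin.castLE hN i)), ?_, fun x hx => ?_⟩
  · rw [finrank_span_eq_card]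
    · simp
    · exact b.orthonormal.linearIndependent.comp _ (Fin.castLE_injective hN)
  · have hzero : ∀ i : Fin (Module.finrank 𝕜 E), N ≤ (i : ℕ) → inner 𝕜 (b i) x = 0 := by
      intro i hi
      have hle : Submodule.span 𝕜 (Set.range fun i : Fin N => b (Fin.castLE hN i)) ≤
          LinearMap.ker (innerₛₗ 𝕜 (b i)) := by
        rw [Submodule.span_le]
        rintro _ ⟨j, rfl⟩
        simp only [SetLike.mem_coe, LinearMap.mem_ker, innerₛₗ_apply_apply]
        refine b.orthonormal.2 fun h => ?_
        have := congrArg Fin.val h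
        simp at this
        omega
      exact hle hx
    refine le_of_sq_le_sq ?_ (norm_nonneg _)
    rw [mul_pow, T.sq_norm_apply_eq_sum, ← b.sum_sq_norm_inner_right x, Finset.mul_sum]
    refine Finset.sum_le_sum fun i _ => ?_
    by_cases hi : N ≤ (i : ℕ)
    · simp [← hb, hzero i hi]
    · refine mul_le_mul_of_nonneg_right ?_ (by positivity)
      rw [← T.sq_singularValues_fin rfl i]
      exact pow_le_pow_left₀ (T.singularValues_nonneg _) (T.singularValues_antitone (by omega)) 2

theorem finrank_range_toEuclideanLin {𝕜 ρ κ : Type*} [RCLike 𝕜] [Fintype ρ] [Fintype κ]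
    [DecidableEq κ] (A : Matrix ρ κ 𝕜) :
    Module.finrank 𝕜 (LinearMap.range (Matrix.toEuclideanLin A)) = A.rank := by
  rw [A.rank_eq_finrank_range_toLin (PiLp.basisFun 2 𝕜 ρ) (PiLp.basisFun 2 𝕜 κ),
    ← Matrix.toLpLin_eq_toLin]

theorem norm_toEuclideanLin_le {𝕜 ρ κ : Type*} [RCLike 𝕜] [Fintype ρ] [Fintype κ]
    [DecidableEq κ] (A : Matrix ρ κ 𝕜) (x : EuclideanSpace 𝕜 κ) :
    ‖Matrix.toEuclideanLin A x‖ ≤ ‖A‖ * ‖x‖ :=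
  A.l2_opNorm_mulVec x

/-- A matrix whose rank is smaller than `N` has distance at least `σ_N(A)` from `A`. -/
theorem matrixSingularValue_le_norm_sub {𝕜 ρ κ : Type*} [RCLike 𝕜] [Fintype ρ] [Fintype κ]
    [DecidableEq κ] (A B : Matrix ρ κ 𝕜) {N : ℕ} (hB : B.rank < N) :
    matrixSingularValue A N ≤ ‖A - B‖ := by
  set T := Matrix.toEuclideanLin A with hT
  have hsd : matrixSingularValue A N = T.singularValues (N - 1) := rfl
  by_cases hN : N ≤ Module.finrank 𝕜 (EuclideanSpace 𝕜 κ)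
  · obtain ⟨W, hWN, hW⟩ := T.exists_submodule_singularValues_mul_norm_le hN
    have hker := (Matrix.toEuclideanLin B).finrank_range_add_finrank_ker
    rw [finrank_range_toEuclideanLin] at hker
    -- W has dimension N, while the kernel of B has codimension less than N, so they share a nonzero
    -- vector; there A and A - B agree.
    have hdis : ¬ Disjoint W (LinearMap.ker (Matrix.toEuclideanLin B)) := fun h => by
      have := Submodule.finrank_add_finrank_le_of_disjoint h
      omega
    rw [Submodule.disjoint_def] at hdis
    push Not at hdis
    obtain ⟨x, hxW, hxB, hx0⟩ := hdis
    have h1 := hW x hxW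
    have h2 : T x = Matrix.toEuclideanLin (A - B) x := by
      rw [map_sub, LinearMap.sub_apply, LinearMap.mem_ker.1 hxB, sub_zero]
    rw [h2] at h1
    exact le_of_mul_le_mul_right (h1.trans (norm_toEuclideanLin_le _ x)) (norm_pos_iff.2 hx0)
  -- Beyond the number of columns the singular values are 0 by convention.
  · rw [hsd, T.singularValues_of_finrank_le (by omega)]
    exact norm_nonneg _

theorem matrixSingularValue_pos {𝕜 ρ κ : Type*} [RCLike 𝕜] [Fintype ρ] [Fintype κ]
    [DecidableEq κ] (A : Matrix ρ κ 𝕜) {N : ℕ} (hN : 0 < N) (hA : N ≤ A.rank) :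
    0 < matrixSingularValue A N := by
  rw [matrixSingularValue, LinearMap.singularValues_pos_iff_lt_finrank_range,
    finrank_range_toEuclideanLin]
  omega

/-! ### Left primeness and full leading rank imply minimality -/

theorem toRational_dotProduct {F ι : Type*} [Field F] [Fintype ι] (v x : ι → F[X]) :
    toRational v ⬝ᵥ toRational x = algebraMap F[X] (RatFunc F) (v ⬝ᵥ x) := by
  simp [toRational, dotProduct]

/-- Predictable degrees: if the leading row-wise coefficient matrix has independent rows, the
degree of a combination of the rows is at least the prescribed degree of each row involved. -/
theorem le_polyVecDegree_sum_smul {F ι : Type*} [Field F] [Fintype ι] {m : ℕ} {d : Fin m → ℕ}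
    {M : Matrix (Fin m) ι F[X]} (hd : M ∈ rowDegreeSpace d)
    (hL : ∀ v : Fin m → F, (∀ l, ∑ j, v j * leadingRowCoeff d M j l = 0) → v = 0)
    {u : Fin m → F[X]} {j : Fin m} (hu : u j ≠ 0) :
    d j ≤ polyVecDegree (∑ i, u i • M i) := by
  classical
  obtain ⟨i, hi, hmax⟩ := Finset.exists_max_image (Finset.univ.filter fun j => u j ≠ 0)
    (fun j => (u j).natDegree + d j) ⟨j, by simpa using hu⟩
  simp only [Finset.mem_filter, Finset.mem_univ, true_and] at hi hmax
  set D := (u i).natDegree + d i with hD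
  have hcoeff : ∀ l, ((∑ i, u i • M i) l).coeff D =
      ∑ k, (u k).coeff (D - d k) * leadingRowCoeff d M k l := by
    intro l
    simp only [Finset.sum_apply, Pi.smul_apply, smul_eq_mul, finsetSum_coeff]
    refine Finset.sum_congr rfl fun k _ => ?_
    by_cases hk : u k = 0
    · simp [hk]
    · have h1 := hmax k hk
      have h2 : D = (D - d k) + d k := by omega
      conv_lhs => rw [h2]
      exact coeff_mul_add_eq_of_natDegree_le (by omega) (hd k l)
  obtain ⟨l, hl⟩ : ∃ l, ((∑ i, u i • M i) l).coeff D ≠ 0 := by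
    by_contra! h
    have h0 := congrFun (hL (fun k => (u k).coeff (D - d k)) fun l => by rw [← hcoeff, h]) i
    simp only [hD, Nat.add_sub_cancel, Pi.zero_apply] at h0
    exact hi (leadingCoeff_eq_zero.1 h0)
  have h1 := hmax j hu
  have h2 := natDegree_le_polyVecDegree (∑ i, u i • M i) l
  have h3 := le_natDegree_of_ne_zero hl
  omega

theorem eq_zero_of_sum_mul_eq_zero_of_surjective {F ι : Type*} [Field F] [Fintype ι] {m : ℕ}
    {A : Matrix (Fin m) ι F} (hA : Function.Surjective A.mulVec) {v : Fin m → F}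
    (hv : ∀ l, ∑ j, v j * A j l = 0) : v = 0 := by
  classical
  ext1 i
  obtain ⟨x, hx⟩ := hA (Pi.single i 1)
  have h1 : v ⬝ᵥ A.mulVec x = 0 := by
    rw [Matrix.dotProduct_mulVec, show Matrix.vecMul v A = 0 from funext hv, zero_dotProduct]
  simpa [hx] using h1

/-- A left prime polynomial matrix with independent leading row coefficients is a minimal basis. -/
theorem isMinimalBasis_of_surjective {F ι : Type*} [Field F] [Fintype ι] {m : ℕ} {d : Fin m → ℕ}
    {M : Matrix (Fin m) ι F[X]} (hd : M ∈ rowDegreeSpace d)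
    (hL : Function.Surjective (leadingRowCoeff d M).mulVec) (hM : Function.Surjective M.mulVec) :
    IsMinimalBasis M := by
  classical
  -- The x j form a polynomial right inverse of M. Pairing with x j reads off the j-th coordinate,
  -- so polynomial vectors in the row space have polynomial coordinates.
  choose x hx using fun j : Fin m => hM (Pi.single j 1)
  have hdot : ∀ i j, M i ⬝ᵥ x j = if i = j then 1 else 0 := fun i j => by
    have h : M i ⬝ᵥ x j = (Pi.single j 1 : Fin m → F[X]) i := congrFun (hx j) i
    rw [h, Pi.single_apply]
  have hcoef : ∀ (g : Fin m → RatFunc F) (j : Fin m),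
      (∑ i, g i • toRational (M i)) ⬝ᵥ toRational (x j) = g j := by
    intro g j
    rw [sum_dotProduct]
    simp only [smul_dotProduct, toRational_dotProduct, hdot]
    simp
  refine ⟨⟨?_, rfl⟩, fun w hw => ?_⟩
  · rw [Fintype.linearIndependent_iff]
    intro g hg j
    rw [← hcoef g j, hg, zero_dotProduct]
  · set U : Matrix (Fin m) (Fin m) F[X] := Matrix.of fun i j => w i ⬝ᵥ x j with hU
    have hwU : ∀ i, w i = ∑ j, U i j • M j := by
      intro i
      apply toRational_injective
      have hmem : toRational (w i) ∈
          Submodule.span (RatFunc F) (Set.range fun i => toRational (M i)) := by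
        rw [← hw.2]
        exact Submodule.subset_span ⟨i, rfl⟩
      obtain ⟨g, hg⟩ := (Submodule.mem_span_range_iff_exists_fun _).1 hmem
      refine Eq.trans ?_ (toRational_sum_smul Finset.univ (U i) (fun j => M j)).symm
      rw [← hg]
      refine Finset.sum_congr rfl fun j _ => ?_
      rw [← hcoef g j, hg, toRational_dotProduct]
      rfl
    have hdet : U.det ≠ 0 := by
      intro h
      obtain ⟨v, hv0, hv⟩ := Matrix.exists_vecMul_eq_zero_iff.2 h
      refine hv0 (funext fun i => ?_)
      have h1 : ∑ i, v i • w i = 0 := by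
        simp only [hwU, Finset.smul_sum, smul_smul]
        rw [Finset.sum_comm]
        simp only [← Finset.sum_smul]
        refine Finset.sum_eq_zero fun j _ => ?_
        rw [show ∑ i, v i * U i j = 0 from congrFun hv j, zero_smul]
      have h2 := Fintype.linearIndependent_iff.1 hw.1
        (fun j => algebraMap F[X] (RatFunc F) (v j))
        (by rw [← toRational_sum_smul, h1, toRational_zero]) i
      simpa using h2
    -- A nonzero term of the determinant matches each row M i with a row w (σ i) that involves it,
    -- so that degrees can be compared row by row.
    rw [Matrix.det_apply] at hdet
    obtain ⟨σ, -, hσ⟩ := Finset.exists_ne_zero_of_sum_ne_zero hdet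
    have hσ' : ∀ i, U (σ i) i ≠ 0 := fun i h =>
      hσ ((congrArg (Equiv.Perm.sign σ • ·) (Finset.prod_eq_zero (f := fun j => U (σ j) j)
        (Finset.mem_univ i) h)).trans (smul_zero _))
    calc ∑ i, polyVecDegree (M i) ≤ ∑ i, d i :=
          Finset.sum_le_sum fun i _ => polyVecDegree_le (hd i)
      _ ≤ ∑ i, polyVecDegree (w (σ i)) := Finset.sum_le_sum fun i _ => by
          rw [hwU]
          exact le_polyVecDegree_sum_smul hd
            (fun _ hv => eq_zero_of_sum_mul_eq_zero_of_surjective hL hv) (hσ' i)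
      _ = ∑ i, polyVecDegree (w i) := Equiv.sum_comp σ fun i => polyVecDegree (w i)

/-! ### Surjectivity with degree bounds -/

theorem coeff_mulVec_eq_zero {F ι : Type*} [Field F] [Fintype ι] {m : ℕ} {d : Fin m → ℕ}
    {M : Matrix (Fin m) ι F[X]} (hd : M ∈ rowDegreeSpace d) {k : ℕ} {x : ι → F[X]}
    (hx : ∀ l t, k ≤ t → (x l).coeff t = 0) (i : Fin m) {t : ℕ} (ht : k + d i ≤ t) :
    (M.mulVec x i).coeff t = 0 := by
  simp only [Matrix.mulVec, dotProduct, finsetSum_coeff]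
  refine Finset.sum_eq_zero fun l _ => ?_
  rcases natDegree_lt_of_coeff_eq_zero (hx l) with h | h
  · simp [h]
  · apply coeff_eq_zero_of_natDegree_lt
    have := hd i l
    exact natDegree_mul_le.trans_lt (by omega)

/-- The top coefficients of `M x` are the leading row-wise coefficient matrix times the top
coefficients of `x`. -/
theorem coeff_mulVec_top {F ι : Type*} [Field F] [Fintype ι] {m : ℕ} {d : Fin m → ℕ}
    {M : Matrix (Fin m) ι F[X]} (hd : M ∈ rowDegreeSpace d) {k : ℕ} {x : ι → F[X]}
    (hx : ∀ l t, k + 1 ≤ t → (x l).coeff t = 0) (i : Fin m) :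
    (M.mulVec x i).coeff (k + d i) =
      (leadingRowCoeff d M).mulVec (fun l => (x l).coeff k) i := by
  simp only [Matrix.mulVec, dotProduct, finsetSum_coeff]
  refine Finset.sum_congr rfl fun l _ => ?_
  rw [add_comm]
  refine coeff_mul_add_eq_of_natDegree_le (hd i l) ?_
  rcases natDegree_lt_of_coeff_eq_zero (hx l) with h | h
  · simp [h]
  · omega

/-- The polynomial map induced by `M` maps the vectors of degree less than `k` onto the vectors
whose `i`-th entry has degree less than `k + d i`. -/
def SurjectiveInDegree {F ι : Type*} [Field F] [Fintype ι] {m : ℕ} (d : Fin m → ℕ) (k : ℕ)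
    (M : Matrix (Fin m) ι F[X]) : Prop :=
  ∀ p : Fin m → F[X], (∀ i t, k + d i ≤ t → (p i).coeff t = 0) →
    ∃ x : ι → F[X], (∀ l t, k ≤ t → (x l).coeff t = 0) ∧ M.mulVec x = p

theorem SurjectiveInDegree.leadingRowCoeff_mulVec_surjective {F ι : Type*} [Field F] [Fintype ι]
    {m : ℕ} {d : Fin m → ℕ} {k : ℕ} {M : Matrix (Fin m) ι F[X]} (hk : 1 ≤ k)
    (hd : M ∈ rowDegreeSpace d) (h : SurjectiveInDegree d k M) :
    Function.Surjective (leadingRowCoeff d M).mulVec := by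
  obtain ⟨k, rfl⟩ := Nat.exists_eq_add_of_le' hk
  intro z
  obtain ⟨x, hx, hxp⟩ := h (fun i => C (z i) * X ^ (k + d i)) fun i t ht => by
    rw [coeff_C_mul_X_pow, if_neg (by omega)]
  refine ⟨fun l => (x l).coeff k, funext fun i => ?_⟩
  rw [← coeff_mulVec_top hd hx, hxp, coeff_C_mul_X_pow, if_pos rfl]

theorem SurjectiveInDegree.mulVec_surjective {F ι : Type*} [Field F] [Fintype ι]
    {m : ℕ} {d : Fin m → ℕ} {k : ℕ} {M : Matrix (Fin m) ι F[X]} (hk : 1 ≤ k)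
    (h : SurjectiveInDegree d k M) : Function.Surjective M.mulVec := by
  classical
  have h1 : ∀ j : Fin m, ∃ x, M.mulVec x = Pi.single j 1 := fun j => by
    obtain ⟨x, -, hx⟩ := h (Pi.single j 1) fun i t ht => by
      rw [Pi.single_apply]
      split_ifs
      · rw [coeff_one, if_neg (by omega)]
      · exact coeff_zero _
    exact ⟨x, hx⟩
  choose x hx using h1
  intro y
  refine ⟨∑ j, y j • x j, ?_⟩
  rw [Matrix.mulVec_sum]
  simp only [Matrix.mulVec_smul, hx]
  ext1 i
  simp [Finset.sum_apply, Pi.single_apply]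

/-- Full rank of M_d lets the top coefficients of a target be removed one layer at a time, until the
i-th entry has degree less than d i; a fixed right inverse then solves the remainder within a degree
bound independent of k. -/
theorem exists_surjectiveInDegree {F ι : Type*} [Field F] [Fintype ι]
    {m : ℕ} {d : Fin m → ℕ} {M : Matrix (Fin m) ι F[X]} (hd : M ∈ rowDegreeSpace d)
    (hL : Function.Surjective (leadingRowCoeff d M).mulVec) (hM : Function.Surjective M.mulVec) :
    ∃ k, 1 ≤ k ∧ SurjectiveInDegree d k M := by
  classical
  choose x hx using fun j : Fin m => hM (Pi.single j 1)
  -- A bound on the degrees of p j • x j once p j has degree less than d j. The claim below holds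
  -- for every k with bound max k e, and is used at k = e.
  set e := Finset.univ.sup (fun j => polyVecDegree (x j)) + Finset.univ.sup d + 1 with he
  have key : ∀ k, ∀ p : Fin m → F[X], (∀ i t, k + d i ≤ t → (p i).coeff t = 0) →
      ∃ y : ι → F[X], (∀ l t, max k e ≤ t → (y l).coeff t = 0) ∧ M.mulVec y = p := by
    intro k
    induction k with
    | zero =>
      intro p hp
      refine ⟨∑ j, p j • x j, fun l t ht => ?_, ?_⟩
      · simp only [Finset.sum_apply, Pi.smul_apply, smul_eq_mul, finsetSum_coeff]
        refine Finset.sum_eq_zero fun j _ => ?_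
        rcases natDegree_lt_of_coeff_eq_zero (hp j) with h | h
        · simp [h]
        · apply coeff_eq_zero_of_natDegree_lt
          have h1 := natDegree_le_polyVecDegree (x j) l
          have h2 := Finset.le_sup (f := fun j => polyVecDegree (x j)) (Finset.mem_univ j)
          have h3 := Finset.le_sup (f := d) (Finset.mem_univ j)
          exact natDegree_mul_le.trans_lt (by omega)
      · rw [Matrix.mulVec_sum]
        simp only [Matrix.mulVec_smul, hx]
        ext1 i
        simp [Finset.sum_apply, Pi.single_apply]
    | succ k ih =>
      intro p hp
      obtain ⟨z, hz⟩ := hL fun i => (p i).coeff (k + d i)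
      set y : ι → F[X] := fun l => C (z l) * X ^ k with hy
      have hyc : ∀ l t, k + 1 ≤ t → (y l).coeff t = 0 := fun l t ht => by
        rw [hy, coeff_C_mul_X_pow, if_neg (by omega)]
      have hyk : (fun l => (y l).coeff k) = z := by
        ext1 l
        rw [hy, coeff_C_mul_X_pow, if_pos rfl]
      obtain ⟨y', hy', hyp⟩ := ih (p - M.mulVec y) fun i t ht => by
        rw [Pi.sub_apply, coeff_sub]
        rcases ht.eq_or_lt with rfl | hlt
        · rw [coeff_mulVec_top hd hyc, hyk, hz, sub_self]
        · rw [hp i t (by omega), coeff_mulVec_eq_zero hd hyc i (by omega), sub_self]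
      refine ⟨y' + y, fun l t ht => ?_, ?_⟩
      · rw [Pi.add_apply, coeff_add, hy' l t (by omega), hyc l t (by omega), add_zero]
      · rw [Matrix.mulVec_add, hyp, sub_add_cancel]
  exact ⟨e, by omega, fun p hp => by simpa using key e p hp⟩

/-! ### Trimmed Sylvester matrices as polynomial maps -/

/-- The polynomial vector whose coefficients are the blocks of a vector. -/
noncomputable def blockPolynomial {F ι : Type*} [Field F] {k : ℕ} (x : Fin k × ι → F) : ι → F[X] :=
  fun l => ∑ c : Fin k, C (x (c, l)) * X ^ (c : ℕ)

theorem coeff_sum_C_mul_X_pow {F : Type*} [Field F] {k : ℕ} (a : Fin k → F) (t : ℕ) :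
    (∑ c : Fin k, C (a c) * X ^ (c : ℕ)).coeff t = if h : t < k then a ⟨t, h⟩ else 0 := by
  simp only [finsetSum_coeff, coeff_C_mul_X_pow]
  split_ifs with h
  · rw [Finset.sum_eq_single ⟨t, h⟩]
    · simp
    · intro c _ hc
      rw [if_neg]
      rintro rfl
      exact hc rfl
    · simp
  · refine Finset.sum_eq_zero fun c _ => if_neg ?_
    have := c.2
    omega

theorem trimmedSylvester_apply {F ι : Type*} [Field F] {m : ℕ} (d : Fin m → ℕ) (k : ℕ)
    (M : Matrix (Fin m) ι F[X]) (p : Σ i : Fin m, Fin (k + d i)) (q : Fin k × ι) :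
    trimmedSylvester d k M p q =
      if (q.1 : ℕ) ≤ (p.2 : ℕ) then (M p.1 q.2).coeff ((p.2 : ℕ) - (q.1 : ℕ)) else 0 := rfl

theorem trimmedSylvester_mulVec {F ι : Type*} [Field F] [Fintype ι] {m : ℕ} (d : Fin m → ℕ) (k : ℕ)
    (M : Matrix (Fin m) ι F[X]) (x : Fin k × ι → F) (p : Σ i : Fin m, Fin (k + d i)) :
    (trimmedSylvester d k M).mulVec x p = (M.mulVec (blockPolynomial x) p.1).coeff p.2 := by
  simp only [Matrix.mulVec, dotProduct, finsetSum_coeff, blockPolynomial, Finset.mul_sum,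
    Fintype.sum_prod_type, trimmedSylvester_apply]
  rw [Finset.sum_comm]
  refine Finset.sum_congr rfl fun l _ => Finset.sum_congr rfl fun c _ => ?_
  rw [← mul_assoc, coeff_mul_X_pow', coeff_mul_C, ite_mul, zero_mul]

theorem trimmedSylvester_mulVec_surjective_iff {F ι : Type*} [Field F] [Fintype ι] {m : ℕ}
    {d : Fin m → ℕ} {k : ℕ} {M : Matrix (Fin m) ι F[X]} (hd : M ∈ rowDegreeSpace d) :
    Function.Surjective (trimmedSylvester d k M).mulVec ↔ SurjectiveInDegree d k M := by
  constructor
  · intro h p hp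
    obtain ⟨x, hx⟩ := h fun r => (p r.1).coeff r.2
    have hxc : ∀ l t, k ≤ t → (blockPolynomial x l).coeff t = 0 := fun l t ht => by
      rw [blockPolynomial, coeff_sum_C_mul_X_pow, dif_neg (by omega)]
    refine ⟨blockPolynomial x, hxc, funext fun i => Polynomial.ext fun t => ?_⟩
    by_cases ht : t < k + d i
    · exact (trimmedSylvester_mulVec d k M x ⟨i, ⟨t, ht⟩⟩).symm.trans (congrFun hx ⟨i, ⟨t, ht⟩⟩)
    · rw [hp i t (by omega), coeff_mulVec_eq_zero hd hxc i (by omega)]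
  · intro h b
    obtain ⟨y, hy, hyp⟩ := h (fun i => ∑ r : Fin (k + d i), C (b ⟨i, r⟩) * X ^ (r : ℕ))
      fun i t ht => by
        rw [coeff_sum_C_mul_X_pow (fun r => b ⟨i, r⟩), dif_neg (by omega)]
    refine ⟨fun q => (y q.2).coeff q.1, funext fun p => ?_⟩
    have hb : blockPolynomial (fun q : Fin k × ι => (y q.2).coeff q.1) = y := by
      ext l t
      rw [blockPolynomial, coeff_sum_C_mul_X_pow (fun c : Fin k => (y l).coeff c)]
      split_ifs with h
      · rfl
      · rw [hy l t (by omega)]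
    rw [trimmedSylvester_mulVec, hb, hyp, coeff_sum_C_mul_X_pow (fun r => b ⟨p.1, r⟩),
      dif_pos p.2.2]

theorem rank_eq_card_iff_mulVec_surjective {F ρ κ : Type*} [Field F] [Fintype ρ] [Fintype κ]
    (A : Matrix ρ κ F) : A.rank = Fintype.card ρ ↔ Function.Surjective A.mulVec := by
  have h : Function.Surjective A.mulVec ↔ LinearMap.range A.mulVecLin = ⊤ :=
    (LinearMap.range_eq_top (f := A.mulVecLin)).symm
  rw [h, Matrix.rank]
  constructor
  · intro h
    exact Submodule.eq_top_of_finrank_eq (by rw [h, Module.finrank_fintype_fun_eq_card])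
  · intro h
    rw [h, finrank_top, Module.finrank_fintype_fun_eq_card]

theorem rank_trimmedSylvester_eq_iff {F ι : Type*} [Field F] [Fintype ι] {m : ℕ}
    {d : Fin m → ℕ} {k : ℕ} {M : Matrix (Fin m) ι F[X]} (hd : M ∈ rowDegreeSpace d) :
    (trimmedSylvester d k M).rank = k * m + ∑ i, d i ↔ SurjectiveInDegree d k M := by
  rw [← trimmedSylvester_mulVec_surjective_iff hd, ← rank_eq_card_iff_mulVec_surjective]
  simp [Finset.sum_add_distrib, mul_comm]

theorem rank_leadingRowCoeff_eq_iff {F ι : Type*} [Field F] [Fintype ι] {m : ℕ}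
    {d : Fin m → ℕ} {M : Matrix (Fin m) ι F[X]} :
    (leadingRowCoeff d M).rank = m ↔ Function.Surjective (leadingRowCoeff d M).mulVec := by
  rw [← rank_eq_card_iff_mulVec_surjective, Fintype.card_fin]

theorem SurjectiveInDegree.isMinimalBasis {F ι : Type*} [Field F] [Fintype ι] {m : ℕ}
    {d : Fin m → ℕ} {k : ℕ} {M : Matrix (Fin m) ι F[X]} (hk : 1 ≤ k) (hd : M ∈ rowDegreeSpace d)
    (h : SurjectiveInDegree d k M) : IsMinimalBasis M :=
  isMinimalBasis_of_surjective hd (h.leadingRowCoeff_mulVec_surjective hk hd)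
    (h.mulVec_surjective hk)

/-! ### Comparing the norms of T_k and T_1 -/

theorem trimmedSylvester_mulVec_eq_sum {F ι : Type*} [Field F] [Fintype ι] {m : ℕ} (d : Fin m → ℕ)
    (k : ℕ) (M : Matrix (Fin m) ι F[X]) (x : Fin k × ι → F) (p : Σ i : Fin m, Fin (k + d i)) :
    (trimmedSylvester d k M).mulVec x p = ∑ c : Fin k, if (c : ℕ) ≤ (p.2 : ℕ) then
      (M.mulVec (fun l => C (x (c, l))) p.1).coeff ((p.2 : ℕ) - c) else 0 := by
  simp only [Matrix.mulVec, dotProduct, finsetSum_coeff, Fintype.sum_prod_type,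
    trimmedSylvester_apply, coeff_mul_C]
  refine Finset.sum_congr rfl fun c _ => ?_
  split_ifs <;> simp

theorem sum_fin_shift_eq {k e c : ℕ} (hc : c < k) {f : ℕ → ℝ} (hf : ∀ t, 1 + e ≤ t → f t = 0) :
    ∑ r : Fin (k + e), (if c ≤ (r : ℕ) then f ((r : ℕ) - c) else 0) =
      ∑ s : Fin (1 + e), f s := by
  rw [Fin.sum_univ_eq_sum_range (fun r => if c ≤ r then f (r - c) else 0) (k + e),
    Fin.sum_univ_eq_sum_range f (1 + e),
    show k + e = c + ((1 + e) + (k - 1 - c)) by omega, Finset.sum_range_add, Finset.sum_range_add]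
  have h1 : ∑ r ∈ Finset.range c, (if c ≤ r then f (r - c) else 0) = 0 :=
    Finset.sum_eq_zero fun r hr => if_neg (by simpa using hr)
  simp only [h1, le_add_iff_nonneg_right, zero_le, if_true, Nat.add_sub_cancel_left, add_assoc,
    zero_add]
  simp [← add_assoc, hf]

/-- Each block column of T_k is a copy of T_1 shifted down and padded with zeros. Cauchy–Schwarz
over the k block columns costs the factor k. -/
theorem sq_norm_trimmedSylvester_mulVec_le {𝕜 ι : Type*} [RCLike 𝕜] [Fintype ι] [DecidableEq ι]
    {m : ℕ} {d : Fin m → ℕ} {M : Matrix (Fin m) ι 𝕜[X]} (hd : M ∈ rowDegreeSpace d) (k : ℕ)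
    (x : Fin k × ι → 𝕜) :
    ∑ p, ‖(trimmedSylvester d k M).mulVec x p‖ ^ 2 ≤
      k * ‖trimmedSylvester d 1 M‖ ^ 2 * ∑ q, ‖x q‖ ^ 2 := by
  set y : Fin k → (Σ i : Fin m, Fin (k + d i)) → 𝕜 := fun c p => if (c : ℕ) ≤ (p.2 : ℕ) then
      (M.mulVec (fun l => C (x (c, l))) p.1).coeff ((p.2 : ℕ) - c) else 0 with hy
  have h1 : ∀ c, ∑ p, ‖y c p‖ ^ 2 =
      ∑ p, ‖(trimmedSylvester d 1 M).mulVec (fun q => x (c, q.2)) p‖ ^ 2 := by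
    intro c
    rw [Fintype.sum_sigma, Fintype.sum_sigma]
    refine Finset.sum_congr rfl fun i _ => ?_
    have h := sum_fin_shift_eq (e := d i) c.2
      (f := fun t => ‖(M.mulVec (fun l => C (x (c, l))) i).coeff t‖ ^ 2) fun t ht => by
        rw [coeff_mulVec_eq_zero hd (k := 1) (fun l t ht => ?_) i ht]
        · simp
        · rw [coeff_C, if_neg (by omega)]
    simp only [trimmedSylvester_mulVec_eq_sum]
    simp only [Fin.sum_univ_one]
    simp only [Fin.val_zero, Nat.sub_zero, Nat.zero_le, if_true]
    rw [← h]
    refine Finset.sum_congr rfl fun r _ => ?_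
    simp only [hy]
    split_ifs <;> simp
  have h2 : ∀ c, ∑ p, ‖y c p‖ ^ 2 ≤ ‖trimmedSylvester d 1 M‖ ^ 2 * ∑ l, ‖x (c, l)‖ ^ 2 := by
    intro c
    rw [h1]
    have h := norm_toEuclideanLin_le (trimmedSylvester d 1 M)
      (WithLp.toLp 2 fun q : Fin 1 × ι => x (c, q.2))
    have h' := pow_le_pow_left₀ (norm_nonneg _) h 2
    rw [mul_pow, EuclideanSpace.norm_sq_eq, EuclideanSpace.norm_sq_eq,
      Fintype.sum_prod_type (f := fun q => _)] at h'
    simpa using h'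
  calc ∑ p, ‖(trimmedSylvester d k M).mulVec x p‖ ^ 2
      ≤ ∑ p, k * ∑ c, ‖y c p‖ ^ 2 := Finset.sum_le_sum fun p _ => by
        rw [trimmedSylvester_mulVec_eq_sum]
        have h3 : ‖∑ c, y c p‖ ^ 2 ≤ (∑ c, ‖y c p‖) ^ 2 :=
          pow_le_pow_left₀ (norm_nonneg _) (norm_sum_le _ _) 2
        refine h3.trans ?_
        simpa using sq_sum_le_card_mul_sum_sq (s := Finset.univ) (f := fun c => ‖y c p‖)
    _ = k * ∑ c, ∑ p, ‖y c p‖ ^ 2 := by rw [← Finset.mul_sum, Finset.sum_comm]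
    _ ≤ k * ∑ c, (‖trimmedSylvester d 1 M‖ ^ 2 * ∑ l, ‖x (c, l)‖ ^ 2) := by
        gcongr with c
        exact h2 c
    _ = k * ‖trimmedSylvester d 1 M‖ ^ 2 * ∑ q, ‖x q‖ ^ 2 := by
        rw [← Finset.mul_sum, Fintype.sum_prod_type, mul_assoc]

/-- The `k`-th trimmed Sylvester matrix has norm at most `√k` times that of the first one. -/
theorem norm_trimmedSylvester_le {𝕜 ι : Type*} [RCLike 𝕜] [Fintype ι] [DecidableEq ι]
    {m : ℕ} {d : Fin m → ℕ} {M : Matrix (Fin m) ι 𝕜[X]} (hd : M ∈ rowDegreeSpace d) (k : ℕ) :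
    ‖trimmedSylvester d k M‖ ≤ √(k : ℝ) * ‖trimmedSylvester d 1 M‖ := by
  rw [Matrix.l2_opNorm_def]
  refine ContinuousLinearMap.opNorm_le_bound _ (by positivity) fun x => ?_
  refine le_of_sq_le_sq ?_ (by positivity)
  rw [mul_pow, mul_pow, Real.sq_sqrt (Nat.cast_nonneg k), EuclideanSpace.norm_sq_eq,
    EuclideanSpace.norm_sq_eq]
  exact sq_norm_trimmedSylvester_mulVec_le hd k x

/-! ### Perturbations and the main theorem -/

theorem trimmedSylvester_sub {F ι : Type*} [Field F] {m : ℕ} (d : Fin m → ℕ) (k : ℕ)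
    (M M' : Matrix (Fin m) ι F[X]) :
    trimmedSylvester d k M - trimmedSylvester d k M' = trimmedSylvester d k (M - M') := by
  ext p q
  simp only [Matrix.sub_apply, trimmedSylvester_apply, coeff_sub]
  split_ifs <;> simp

theorem sub_mem_rowDegreeSpace {F ι : Type*} [Field F] {m : ℕ} {d : Fin m → ℕ}
    {M M' : Matrix (Fin m) ι F[X]} (h : M ∈ rowDegreeSpace d) (h' : M' ∈ rowDegreeSpace d) :
    M - M' ∈ rowDegreeSpace d := fun i j =>
  (natDegree_sub_le_of_le (h i j) (h' i j)).trans (max_self _).le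

theorem IsMinimalBasis.not_isMinimalBasis_of_row_eq_mul {F ι : Type*} [Field F] [Fintype ι]
    {m : ℕ} {M M' : Matrix (Fin m) ι F[X]} (hM : IsMinimalBasis M) {i : Fin m} {p : F[X]}
    (hp : 0 < p.natDegree) (hi : ∀ l, M' i l = p * M i l)
    (hne : ∀ a, a ≠ i → ∀ l, M' a l = M a l) : ¬ IsMinimalBasis M' := by
  have h : (M' : Fin m → ι → F[X]) = Function.update M i (p • M i) := by
    refine Function.eq_update_iff.2 ⟨funext hi, fun a ha => funext (hne a ha)⟩
  intro h'
  refine IsMinimalBasisOf.not_isMinimalBasisOf_update_smul hM i hp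
    (Submodule.span (RatFunc F) (Set.range fun i => toRational (M' i))) ?_
  exact h ▸ h'

/-- A minimal basis with a row of smaller degree than prescribed is a limit of polynomial matrices
that are not minimal bases. -/
theorem exists_not_isMinimalBasis_of_polyVecDegree_lt {𝕜 ι : Type*} [RCLike 𝕜] [Fintype ι]
    [DecidableEq ι] {m : ℕ} {d : Fin m → ℕ} {M : Matrix (Fin m) ι 𝕜[X]}
    (hd : M ∈ rowDegreeSpace d) (hM : IsMinimalBasis M) {i : Fin m}
    (hi : polyVecDegree (M i) < d i) {ε : ℝ} (hε : 0 < ε) :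
    ∃ M' : Matrix (Fin m) ι 𝕜[X], M' ∈ rowDegreeSpace d ∧ ¬ IsMinimalBasis M' ∧
      ‖trimmedSylvester d 1 M - trimmedSylvester d 1 M'‖ < ε := by
  set N : Matrix (Fin m) ι 𝕜[X] := Matrix.of fun a l => if a = i then X * M i l else 0 with hN
  set B := ‖trimmedSylvester d 1 N‖ with hB
  -- The perturbation has norm δ B; adding 1 covers B = 0 and makes the bound strict.
  set δ : ℝ := ε / (B + 1) with hδ
  have hB0 : 0 ≤ B := norm_nonneg _
  have hδ0 : 0 < δ := by positivity
  have hδ' : (δ : 𝕜) ≠ 0 := by exact_mod_cast hδ0.ne'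
  set p : 𝕜[X] := C (δ : 𝕜) * X + C 1 with hp
  have hpd : p.natDegree = 1 := natDegree_linear hδ'
  set M' : Matrix (Fin m) ι 𝕜[X] := Matrix.of fun a l => if a = i then p * M i l else M a l with hM'
  have hMi : ∀ l, M' i l = p * M i l := fun l => if_pos rfl
  have hMa : ∀ a, a ≠ i → ∀ l, M' a l = M a l := fun a ha l => if_neg ha
  refine ⟨M', fun a l => ?_, hM.not_isMinimalBasis_of_row_eq_mul (by omega) hMi hMa, ?_⟩
  · by_cases ha : a = i
    · subst ha
      rw [hMi]
      have h1 := natDegree_le_polyVecDegree (M a) l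
      exact natDegree_mul_le.trans (by omega)
    · rw [hMa a ha]
      exact hd a l
  · have h : M - M' = -((C (δ : 𝕜)) • N) := by
      ext1 a l
      rw [Matrix.sub_apply, Matrix.neg_apply, Matrix.smul_apply, hN, Matrix.of_apply, smul_eq_mul]
      by_cases ha : a = i
      · subst ha
        rw [hMi, if_pos rfl, hp, C_1]
        ring
      · rw [hMa a ha, if_neg ha]
        simp
    have h' : trimmedSylvester d 1 (-((C (δ : 𝕜)) • N)) = -((δ : 𝕜) • trimmedSylvester d 1 N) := by
      ext r q
      simp only [Matrix.neg_apply, Matrix.smul_apply, trimmedSylvester_apply, coeff_neg,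
        smul_eq_mul, coeff_C_mul]
      split_ifs <;> simp
    rw [trimmedSylvester_sub, h, h', norm_neg, norm_smul, RCLike.norm_ofReal, abs_of_pos hδ0, ← hB,
      hδ, div_mul_eq_mul_div, div_lt_iff₀ (by positivity)]
    nlinarith

theorem mainTheorem5 {𝕜 : Type*} [RCLike 𝕜] (m n : ℕ) (hm : 0 < m) (d : Fin m → ℕ)
    (M : Matrix (Fin m) (Fin (m + n)) 𝕜[X])
    (hM : M ∈ rowDegreeSpace d) (hmin : IsMinimalBasis M) :
    ((leadingRowCoeff d M).rank < m →
      ∀ ε : ℝ, 0 < ε →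
        ∃ M' : Matrix (Fin m) (Fin (m + n)) 𝕜[X], M' ∈ rowDegreeSpace d ∧
          ¬ IsMinimalBasis M' ∧
          ‖trimmedSylvester d 1 M - trimmedSylvester d 1 M'‖ < ε) ∧
    ((leadingRowCoeff d M).rank = m →
      (∃ k : ℕ, 1 ≤ k ∧ (trimmedSylvester d k M).rank = k * m + ∑ i, d i) ∧
      ∀ k : ℕ, 1 ≤ k → (trimmedSylvester d k M).rank = k * m + ∑ i, d i →
        0 < matrixSingularValue (trimmedSylvester d k M) (k * m + ∑ i, d i) ∧
        ∀ M' : Matrix (Fin m) (Fin (m + n)) 𝕜[X], M' ∈ rowDegreeSpace d →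
          ‖trimmedSylvester d 1 M - trimmedSylvester d 1 M'‖ <
            matrixSingularValue (trimmedSylvester d k M) (k * m + ∑ i, d i) / √(k : ℝ) →
          IsMinimalBasis M' ∧ (leadingRowCoeff d M').rank = m) := by
  refine ⟨fun hr ε hε => ?_, fun hr => ⟨?_, fun k hk hT => ?_⟩⟩
  · obtain ⟨i, hi⟩ := IsMinimalBasisOf.exists_polyVecDegree_lt hmin hM hr
    exact exists_not_isMinimalBasis_of_polyVecDegree_lt hM hmin hi hε
  · obtain ⟨k, hk, h⟩ := exists_surjectiveInDegree hM (rank_leadingRowCoeff_eq_iff.1 hr)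
      (IsMinimalBasisOf.mulVec_surjective hmin)
    exact ⟨k, hk, (rank_trimmedSylvester_eq_iff hM).2 h⟩
  · refine ⟨matrixSingularValue_pos _ (by positivity) hT.ge, fun M' hM' hlt => ?_⟩
    have hk0 : 0 < √(k : ℝ) := Real.sqrt_pos.2 (by exact_mod_cast hk)
    have hnorm : ‖trimmedSylvester d k M - trimmedSylvester d k M'‖ <
        matrixSingularValue (trimmedSylvester d k M) (k * m + ∑ i, d i) := by
      rw [lt_div_iff₀ hk0, trimmedSylvester_sub, mul_comm] at hlt
      rw [trimmedSylvester_sub]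
      exact (norm_trimmedSylvester_le (sub_mem_rowDegreeSpace hM hM') k).trans_lt hlt
    have hrank : (trimmedSylvester d k M').rank = k * m + ∑ i, d i := by
      -- A rank drop would put T_k(M') at distance at least the last singular value from T_k(M).
      refine le_antisymm ?_ (not_lt.1 fun h => (matrixSingularValue_le_norm_sub _ _ h).not_gt hnorm)
      refine (Matrix.rank_le_card_height _).trans_eq ?_
      simp [Finset.sum_add_distrib, mul_comm]
    have hS := (rank_trimmedSylvester_eq_iff hM').1 hrank
    exact ⟨hS.isMinimalBasis hk hM',
      rank_leadingRowCoeff_eq_iff.2 (hS.leadingRowCoeff_mulVec_surjective hk hM')⟩
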